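/- Let $H$ be a real Hilbert space and let $W=(W(h))_{h\in H}$ be an isonormal process on a probability space $(\Omega,\mathcal F,P)$, i.e. a centered Gaussian family with $E[W(h)W(k)]=\langle h,k\rangle_H$ for all $h,k\in H$. For $n\ge 0$ let $I_n$ denote the multiple Wiener–Itô integral of order $n$, i.e. the continuous linear map from the symmetric tensors of the Hilbert tensor power $H^{\otimes n}$ to $L^2(\Omega)$ with $I_n(h^{\otimes n})=H_n(W(h))$ for $\|h\|=1$, where $H_n$ is the monic (probabilists') Hermite polynomial of degree $n$. Let $D$ be the Malliavin derivative, i.e. the closure in $L^2(\Omega)\times L^2(\Omega;H)$ of $p(W(x_1),\dots,W(x_k))\mapsto\sum_i \partial_i p(W(x_1),\dots,W(x_k))\,x_i$ ($p$ a polynomial). For a random vector $(F,G)$ write $$\Lambda=\begin{pmatrix}\|DF\|_H^2&\langle DF,DG\rangle_H\\ \langle DF,DG\rangle_H&\|DG\|_H^2\end{pmatrix},\qquad C=\begin{pmatrix}\mathrm{Var}(F)&\mathrm{Cov}(F,G)\\ \mathrm{Cov}(F,G)&\mathrm{Var}(G)\end{pmatrix}$$ for its Malliavin matrix and its covariance matrix.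 Fix $h\in H$ with $\|h\|=1$. (1) If $F=I_1(h)$ and $G=I_2(h^{\otimes 2})$, then $\det C=2$ and $\det\Lambda=0$ almost surely. (2) More generally, let $n,m\ge 1$ with $n\ne m$, and let $F=I_n(h^{\otimes n})$, $G=I_m(h^{\otimes m})$. Then $F$ and $G$ are in the domain of $D$, $\det\Lambda=0$ almost surely, and $\det C=n!\,m!\neq 0$. The law of $(F,G)$ is not absolutely continuous with respect to Lebesgue measure on $\mathbb R^2$, and $F$ and $G$ are not proportional: no relation $aF+bG=0$ almost surely holds with $(a,b)\ne(0,0)$. Thus the dichotomy "either the vector has a density or its components are proportional" fails for chaoses of different orders. -/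

import Mathlib

open MeasureTheory ProbabilityTheory
open scoped TensorProduct RealInnerProductSpace ENNReal

namespace WienerChaos

section HilbertTensorPower

variable (H : Type*) [NormedAddCommGroup H] [InnerProductSpace ℝ H] (n : ℕ)

/-- The bilinear form on the algebraic tensor power with
`⟨x₁ ⊗ ⋯ ⊗ xₙ, y₁ ⊗ ⋯ ⊗ yₙ⟩ = ∏ᵢ ⟨xᵢ, yᵢ⟩`. -/
noncomputable def tensorForm :
    (⨂[ℝ] (_ : Fin n), H) →ₗ[ℝ] Module.Dual ℝ (⨂[ℝ] (_ : Fin n), H) :=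
  (PiTensorProduct.dualDistrib (R := ℝ) (M := fun _ : Fin n => H)) ∘ₗ
    (PiTensorProduct.map (fun _ : Fin n => innerₗ H))

variable {H n}

theorem tensorForm_tprod (x y : Fin n → H) :
    tensorForm H n (PiTensorProduct.tprod ℝ x) (PiTensorProduct.tprod ℝ y) =
      ∏ i, ⟪x i, y i⟫ := by
  unfold tensorForm
  rw [LinearMap.comp_apply, PiTensorProduct.map_tprod, PiTensorProduct.dualDistrib_apply]
  rfl

theorem exists_sum_tprod (t : ⨂[ℝ] (_ : Fin n), H) :
    ∃ c : (Fin n → H) →₀ ℝ, (c.sum fun x a => a • PiTensorProduct.tprod ℝ x) = t := by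
  have h : t ∈ Submodule.span ℝ
      (Set.range (PiTensorProduct.tprod ℝ (s := fun _ : Fin n => H))) := by
    rw [PiTensorProduct.span_tprod_eq_top]; trivial
  exact (Finsupp.mem_span_range_iff_exists_finsupp).1 h

theorem tensorForm_sum (c d : (Fin n → H) →₀ ℝ) :
    tensorForm H n (c.sum fun x a => a • PiTensorProduct.tprod ℝ x)
        (d.sum fun x a => a • PiTensorProduct.tprod ℝ x) =
      ∑ x ∈ c.support, ∑ y ∈ d.support, c x * (d y * ∏ i, ⟪x i, y i⟫) := by
  simp only [Finsupp.sum, map_sum, map_smul, LinearMap.sum_apply, LinearMap.smul_apply,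
    tensorForm_tprod, smul_eq_mul, Finset.mul_sum]
  rw [Finset.sum_comm]
  refine Finset.sum_congr rfl fun x _ => Finset.sum_congr rfl fun y _ => ?_
  ring

theorem tensorForm_symm (s t : ⨂[ℝ] (_ : Fin n), H) :
    tensorForm H n s t = tensorForm H n t s := by
  obtain ⟨c, rfl⟩ := exists_sum_tprod s
  obtain ⟨d, rfl⟩ := exists_sum_tprod t
  rw [tensorForm_sum, tensorForm_sum, Finset.sum_comm]
  refine Finset.sum_congr rfl fun x _ => Finset.sum_congr rfl fun y _ => ?_
  rw [Finset.prod_congr rfl fun i _ => real_inner_comm (x i) (y i)]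
  ring

theorem tensorForm_self_nonneg (t : ⨂[ℝ] (_ : Fin n), H) : 0 ≤ tensorForm H n t t := by
  obtain ⟨c, rfl⟩ := exists_sum_tprod t
  have key : ∀ s : Finset (Fin n),
      (Matrix.of fun (x y : c.support) => ∏ i ∈ s, ⟪x.1 i, y.1 i⟫ : Matrix _ _ ℝ).PosSemidef := by
    intro s
    induction s using Finset.induction_on with
    | empty =>
      have e : (Matrix.of fun (x y : c.support) => ∏ i ∈ ∅, ⟪x.1 i, y.1 i⟫ : Matrix _ _ ℝ) =
          Matrix.gram ℝ (fun _ : c.support => (1 : ℝ)) := by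
        ext x y
        simp [Matrix.gram_apply]
      rw [e]
      exact Matrix.posSemidef_gram (𝕜 := ℝ) (fun _ : c.support => (1 : ℝ))
    | insert a s ha ih =>
      have e : (Matrix.of fun (x y : c.support) => ∏ i ∈ insert a s, ⟪x.1 i, y.1 i⟫ :
          Matrix _ _ ℝ) = (Matrix.gram ℝ (fun x : c.support => x.1 a)).hadamard
            (Matrix.of fun (x y : c.support) => ∏ i ∈ s, ⟪x.1 i, y.1 i⟫) := by
        ext x y
        simp [Matrix.gram_apply, Finset.prod_insert ha]
      rw [e]
      exact (Matrix.posSemidef_gram (𝕜 := ℝ) (fun x : c.support => x.1 a)).hadamard ih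
  have h := (key Finset.univ).dotProduct_mulVec_nonneg (fun x : c.support => c x.1)
  rw [tensorForm_sum, ← Finset.sum_coe_sort]
  refine h.trans_eq ?_
  simp only [dotProduct, Matrix.mulVec, Finset.mul_sum, Matrix.of_apply]
  refine Finset.sum_congr rfl fun x _ => ?_
  rw [← Finset.sum_coe_sort c.support]
  refine Finset.sum_congr rfl fun y _ => ?_
  simp only [star_trivial]
  ring

variable (H n)

/-- The algebraic `n`-fold tensor power of `H`. (A separate name, because Mathlib puts the
projective seminorm on `⨂[ℝ] _, H`, and here the Hilbert norm is wanted.) -/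
def AlgTensorPower : Type _ := ⨂[ℝ] (_ : Fin n), H

noncomputable instance : AddCommGroup (AlgTensorPower H n) :=
  inferInstanceAs (AddCommGroup (⨂[ℝ] (_ : Fin n), H))

noncomputable instance : Module ℝ (AlgTensorPower H n) :=
  inferInstanceAs (Module ℝ (⨂[ℝ] (_ : Fin n), H))

variable {H n}

/-- The elementary tensor `x₁ ⊗ ⋯ ⊗ xₙ`. -/
noncomputable def algTprod (x : Fin n → H) : AlgTensorPower H n :=
  PiTensorProduct.tprod ℝ x

variable (H n)

/-- The (pre-)inner product on the algebraic tensor power. -/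
@[reducible]
noncomputable def tensorCore : PreInnerProductSpace.Core ℝ (AlgTensorPower H n) where
  inner s t := tensorForm H n s t
  conj_inner_symm s t := by simpa using tensorForm_symm t s
  re_inner_nonneg t := by simpa using tensorForm_self_nonneg t
  add_left s t u := LinearMap.congr_fun ((tensorForm H n).map_add s t) u
  smul_left s t r := LinearMap.congr_fun ((tensorForm H n).map_smul r s) t

noncomputable instance : SeminormedAddCommGroup (AlgTensorPower H n) :=
  @InnerProductSpace.Core.toSeminormedAddCommGroup ℝ (AlgTensorPower H n) _ _ _ (tensorCore H n)

noncomputable instance : InnerProductSpace ℝ (AlgTensorPower H n) :=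
  InnerProductSpace.ofCore (tensorCore H n)

/-- The Hilbert space tensor power `H^{⊗ n}`: the Hilbert completion of the algebraic tensor
power. -/
abbrev HilbertTensorPower : Type _ := UniformSpace.Completion (AlgTensorPower H n)

variable {H}

/-- The tensor power `h^{⊗ n}` of a vector. -/
noncomputable def tensorPow (h : H) : HilbertTensorPower H n :=
  ((algTprod fun _ : Fin n => h : AlgTensorPower H n) : HilbertTensorPower H n)

/-- The inner product of `H^{⊗ n}` has its usual values on tensor powers. -/
theorem inner_tensorPow (h k : H) :
    ⟪tensorPow n h, tensorPow n k⟫ = ⟪h, k⟫ ^ n := by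
  unfold tensorPow
  rw [UniformSpace.Completion.inner_coe]
  refine (tensorForm_tprod _ _).trans ?_
  simp

end HilbertTensorPower

section Chaos

variable {Ω : Type*} [MeasurableSpace Ω] {H : Type*} [NormedAddCommGroup H]
  [InnerProductSpace ℝ H]

/-- `W = (W(h))_{h ∈ H}` is an isonormal process on `(Ω, P)`: a centered Gaussian family with
`E[W(h) W(k)] = ⟨h, k⟩`. -/
structure IsIsonormal (W : H → Ω → ℝ) (P : Measure Ω) : Prop where
  gaussian : IsGaussianProcess W P
  centered : ∀ h, ∫ ω, W h ω ∂P = 0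
  covariance : ∀ h k, ∫ ω, W h ω * W k ω ∂P = ⟪h, k⟫

/-- The graph of the multiple Wiener–Itô integral `Iₙ` of the process `W`, as a subspace of
`H^{⊗ n} × L²(P)`: the closed linear span of the pairs `(h^{⊗ n}, Hₙ(W(h)))`, `‖h‖ = 1`, where `Hₙ`
is the monic (probabilists') Hermite polynomial. Its domain is the space of symmetric tensors. -/
noncomputable def multipleIntegralGraph (W : H → Ω → ℝ) (P : Measure Ω) (n : ℕ) :
    Submodule ℝ (HilbertTensorPower H n × Lp ℝ 2 P) :=
  (Submodule.span ℝ {q | ∃ h : H, ‖h‖ = 1 ∧ q.1 = tensorPow n h ∧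
    q.2 =ᵐ[P] fun ω => Polynomial.aeval (W h ω) (Polynomial.hermite n)}).topologicalClosure

/-- The multiple Wiener–Itô integral `Iₙ(f) ∈ L²(P)` of a symmetric `f ∈ H^{⊗ n}`
(and `0` if `f` is not in the domain). -/
noncomputable def multipleIntegral (W : H → Ω → ℝ) (P : Measure Ω) (n : ℕ)
    (f : HilbertTensorPower H n) : Lp ℝ 2 P :=
  open Classical in
  if hf : ∃ F, (f, F) ∈ multipleIntegralGraph W P n then hf.choose else 0

/-- The graph of the Malliavin derivative `D`, as a subspace of `L²(P) × L²(P; H)`: the closure of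
the operator `p(W(x₁), …, W(x_k)) ↦ ∑ᵢ ∂ᵢp(W(x₁), …, W(x_k)) xᵢ` on polynomial cylindrical random
variables. -/
noncomputable def malliavinGraph (W : H → Ω → ℝ) (P : Measure Ω) :
    Submodule ℝ (Lp ℝ 2 P × Lp H 2 P) :=
  (Submodule.span ℝ {q | ∃ (k : ℕ) (x : Fin k → H) (p : MvPolynomial (Fin k) ℝ),
    (q.1 =ᵐ[P] fun ω => MvPolynomial.eval (fun i => W (x i) ω) p) ∧
    (q.2 =ᵐ[P] fun ω => ∑ i, MvPolynomial.eval (fun j => W (x j) ω) (MvPolynomial.pderiv i p) • x i)}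
    ).topologicalClosure

/-- `F` is in the domain of the Malliavin derivative. -/
def IsMalliavinDifferentiable (W : H → Ω → ℝ) (P : Measure Ω) (F : Lp ℝ 2 P) : Prop :=
  ∃ U, (F, U) ∈ malliavinGraph W P

/-- The Malliavin derivative `DF ∈ L²(P; H)` (and `0` if `F` is not in the domain). -/
noncomputable def malliavinDeriv (W : H → Ω → ℝ) (P : Measure Ω) (F : Lp ℝ 2 P) : Lp H 2 P :=
  open Classical in
  if hF : IsMalliavinDifferentiable W P F then hF.choose else 0

/-- The Malliavin matrix `Λ` of the random vector `(F, G)`. -/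
noncomputable def malliavinMatrix (W : H → Ω → ℝ) (P : Measure Ω) (F G : Lp ℝ 2 P) (ω : Ω) :
    Matrix (Fin 2) (Fin 2) ℝ :=
  !![⟪malliavinDeriv W P F ω, malliavinDeriv W P F ω⟫,
      ⟪malliavinDeriv W P F ω, malliavinDeriv W P G ω⟫;
    ⟪malliavinDeriv W P G ω, malliavinDeriv W P F ω⟫,
      ⟪malliavinDeriv W P G ω, malliavinDeriv W P G ω⟫]

/-- The covariance matrix `C` of the random vector `(F, G)`. -/
noncomputable def covMatrix (P : Measure Ω) (F G : Lp ℝ 2 P) : Matrix (Fin 2) (Fin 2) ℝ :=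
  !![cov[F, F; P], cov[F, G; P]; cov[G, F; P], cov[G, G; P]]

/-- The random vector `(F, G)` admits a density: its law is absolutely continuous with respect to
Lebesgue measure on `ℝ²`. -/
def HasJointDensity (P : Measure Ω) (F G : Lp ℝ 2 P) : Prop :=
  P.map (fun ω => (F ω, G ω)) ≪ (volume : Measure (ℝ × ℝ))

/-- `F` and `G` are proportional: they satisfy a nontrivial linear relation. -/
def AreProportional (P : Measure Ω) (F G : Lp ℝ 2 P) : Prop :=
  ∃ a b : ℝ, (a ≠ 0 ∨ b ≠ 0) ∧ a • F + b • G = 0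

end Chaos

end WienerChaos

/-!
Everything rests on the Gaussian integration by parts `E[W(g) p(W)] = E[(∂_g p)(W)]` for polynomials
`p`, where `∂_g` is the derivation sending `W(x)` to `⟪x, g⟫`; it is Stein's lemma conditionally on
the part of `W` independent of `W(g)`. Since `Hₙ₊₁(W(h)) = W(h) Hₙ(W(h)) - ∂_h Hₙ(W(h))`, iterating
it gives `E[Hₙ(W(h)) p(W)] = E[(∂_hⁿ p)(W)]`, hence the orthogonality of Hermite polynomials and the
isometry making `Iₙ` well defined; it also makes `D` closable.

The variables `F = Hₙ(W(h))` and `G = Hₘ(W(h))` are functions of the single Gaussian `W(h)`. So `DF`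
and `DG` are both multiples of `h`, whence `det Λ = 0`, and `(F, G)` stays on a smooth curve, which
is Lebesgue null. Orthogonality gives `C = diag(n!, m!)`, whereas a linear relation between `F` and
`G` would force `det C = 0`.
-/

namespace WienerChaos

section DirectionalDerivative

variable {R ι : Type*} [CommSemiring R]

/-- The derivative of polynomials in the direction `a`: the derivation `∑ᵢ aᵢ ∂ᵢ`, which makes sense
for infinitely many variables because a polynomial involves only finitely many. -/
noncomputable def dirDeriv (a : ι → R) : Derivation R (MvPolynomial ι R) (MvPolynomial ι R) :=
  MvPolynomial.mkDerivation R fun i => MvPolynomial.C (a i)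

@[simp]
theorem dirDeriv_X (a : ι → R) (i : ι) :
    dirDeriv a (MvPolynomial.X i) = MvPolynomial.C (a i) :=
  MvPolynomial.mkDerivation_X _ _ _

theorem dirDeriv_smul (c : R) (a : ι → R) : dirDeriv (c • a) = c • dirDeriv a :=
  MvPolynomial.derivation_ext fun i => by simp [MvPolynomial.smul_eq_C_mul]

theorem dirDeriv_rename {κ : Type*} (a : ι → R) (f : κ → ι) (p : MvPolynomial κ R) :
    dirDeriv a (MvPolynomial.rename f p) = MvPolynomial.rename f (dirDeriv (a ∘ f) p) := by
  induction p using MvPolynomial.induction_on with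
  | C c => simp
  | add p q hp hq => simp only [map_add, hp, hq]
  | mul_X p i hp => simp [hp, Derivation.leibniz]

theorem dirDeriv_eq_sum_pderiv [Fintype ι] (a : ι → R) (p : MvPolynomial ι R) :
    dirDeriv a p = ∑ i, a i • MvPolynomial.pderiv i p := by
  classical
  induction p using MvPolynomial.induction_on with
  | C c => simp
  | add p q hp hq => simp only [map_add, smul_add, Finset.sum_add_distrib, hp, hq]
  | mul_X p i hp =>
    simp [Derivation.leibniz, hp, MvPolynomial.pderiv_X, Pi.single_apply, Finset.sum_add_distrib,
      Finset.mul_sum, MvPolynomial.smul_eq_C_mul, mul_comm, mul_left_comm]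

theorem dirDeriv_aeval_X (a : ι → R) (i : ι) (q : Polynomial R) :
    dirDeriv a (Polynomial.aeval (MvPolynomial.X i) q) =
      a i • Polynomial.aeval (MvPolynomial.X i) q.derivative := by
  rw [Derivation.map_aeval, dirDeriv_X, smul_eq_mul, mul_comm, MvPolynomial.smul_eq_C_mul]

theorem iterate_dirDeriv_aeval_X (a : ι → R) (i : ι) (n : ℕ) (q : Polynomial R) :
    (dirDeriv a)^[n] (Polynomial.aeval (MvPolynomial.X i) q) =
      a i ^ n • Polynomial.aeval (MvPolynomial.X i) (Polynomial.derivative^[n] q) := by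
  induction n with
  | zero => simp
  | succ n ih =>
    rw [Function.iterate_succ_apply', ih, Derivation.map_smul, dirDeriv_aeval_X, smul_smul,
      ← pow_succ, Function.iterate_succ_apply']

theorem eval_aeval_X (x : ι → R) (i : ι) (q : Polynomial R) :
    MvPolynomial.eval x (Polynomial.aeval (MvPolynomial.X i) q) = q.eval (x i) := by
  have h := Polynomial.aeval_algHom_apply (MvPolynomial.aeval (R := R) x) (MvPolynomial.X i) q
  simpa [MvPolynomial.aeval_eq_eval, Polynomial.coe_aeval_eq_eval] using h.symm

theorem hasDerivAt_eval_add_smul {𝕜 : Type*} [NontriviallyNormedField 𝕜]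
    (p : MvPolynomial ι 𝕜) (y a : ι → 𝕜) (t : 𝕜) :
    HasDerivAt (fun t : 𝕜 => MvPolynomial.eval (y + t • a) p)
      (MvPolynomial.eval (y + t • a) (dirDeriv a p)) t := by
  induction p using MvPolynomial.induction_on with
  | C c => simpa using hasDerivAt_const t c
  | add p q hp hq => simpa only [map_add] using hp.fun_add hq
  | mul_X p i hp =>
    have hX : HasDerivAt (fun t : 𝕜 => y i + t * a i) (a i) t := by
      simpa using ((hasDerivAt_id t).mul_const (a i)).const_add (y i)
    simpa [Derivation.leibniz, mul_comm, add_comm] using hp.fun_mul hX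

end DirectionalDerivative

section SteinLemma

theorem hasDerivAt_gaussianPDFReal (μ : ℝ) {v : NNReal} (hv : v ≠ 0) (x : ℝ) :
    HasDerivAt (gaussianPDFReal μ v) (-((x - μ) / v) * gaussianPDFReal μ v x) x := by
  rw [gaussianPDFReal_def]
  have hv' : (v : ℝ) ≠ 0 := by exact_mod_cast hv
  have hexponent : HasDerivAt (fun x : ℝ => -(x - μ) ^ 2 / (2 * v)) (-((x - μ) / v)) x := by
    convert! ((((hasDerivAt_id x).sub_const μ).pow 2).neg).div_const (2 * (v : ℝ)) using 1
    simp only [Nat.cast_ofNat, id_eq, Nat.add_one_sub_one, pow_one, mul_one]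
    field_simp
  convert! hexponent.exp.const_mul _ using 1
  ring

theorem integrable_gaussianReal_iff {μ : ℝ} {v : NNReal} (hv : v ≠ 0) {f : ℝ → ℝ} :
    Integrable f (gaussianReal μ v) ↔ Integrable fun x => gaussianPDFReal μ v x * f x := by
  rw [gaussianReal_of_var_ne_zero μ hv, integrable_withDensity_iff_integrable_smul'
    (measurable_gaussianPDF μ v) (.of_forall fun _ => gaussianPDF_lt_top)]
  simp [toReal_gaussianPDF]

theorem integral_sub_mul_gaussianReal {μ : ℝ} {v : NNReal} {f f' : ℝ → ℝ}
    (hderiv : ∀ x, HasDerivAt f (f' x) x) (hf : Integrable f (gaussianReal μ v))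
    (hxf : Integrable (fun x => (x - μ) * f x) (gaussianReal μ v))
    (hf' : Integrable f' (gaussianReal μ v)) :
    ∫ x, (x - μ) * f x ∂gaussianReal μ v = v * ∫ x, f' x ∂gaussianReal μ v := by
  rcases eq_or_ne v 0 with rfl | hv
  · simp [gaussianReal_zero_var]
  have hprod (x : ℝ) : HasDerivAt (fun x => gaussianPDFReal μ v x * f x)
      (gaussianPDFReal μ v x * f' x - (v : ℝ)⁻¹ * (gaussianPDFReal μ v x * ((x - μ) * f x))) x := by
    convert! (hasDerivAt_gaussianPDFReal μ hv x).mul (hderiv x) using 1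
    ring
  rw [integrable_gaussianReal_iff hv] at hf hxf hf'
  have hzero := integral_eq_zero_of_hasDerivAt_of_integrable hprod (hf'.sub (hxf.const_mul _)) hf
  rw [integral_sub hf' (hxf.const_mul _), integral_const_mul, sub_eq_zero] at hzero
  simp only [integral_gaussianReal_eq_integral_smul hv, smul_eq_mul, hzero]
  rw [mul_inv_cancel_left₀ (by exact_mod_cast hv)]

variable {Ω E : Type*} [MeasurableSpace Ω] [MeasurableSpace E] {P : Measure Ω}

-- Conditionally on `Y`, this is Stein's lemma for the function `f (Y ω)`.
theorem integral_mul_of_indepFun_gaussianReal {Y : Ω → E} {Z : Ω → ℝ} {v : NNReal}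
    (hY : AEMeasurable Y P) (hZ : HasLaw Z (gaussianReal 0 v) P) (hYZ : IndepFun Y Z P)
    {f f' : E → ℝ → ℝ} (hderiv : ∀ y z, HasDerivAt (f y) (f' y z) z)
    (hf_meas : Measurable fun q : E × ℝ => f q.1 q.2)
    (hf'_meas : Measurable fun q : E × ℝ => f' q.1 q.2)
    (hf : Integrable (fun ω => f (Y ω) (Z ω)) P)
    (hZf : Integrable (fun ω => Z ω * f (Y ω) (Z ω)) P)
    (hf' : Integrable (fun ω => f' (Y ω) (Z ω)) P) :
    ∫ ω, Z ω * f (Y ω) (Z ω) ∂P = v * ∫ ω, f' (Y ω) (Z ω) ∂P := by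
  have := hZ.isProbabilityMeasure
  have : IsProbabilityMeasure (P.map Y) := Measure.isProbabilityMeasure_map hY
  have hlaw : HasLaw (fun ω => (Y ω, Z ω)) ((P.map Y).prod (gaussianReal 0 v)) P :=
    IndepFun.hasLaw_prod ⟨hY, rfl⟩ hZ hYZ
  have hZf_meas : Measurable fun q : E × ℝ => q.2 * f q.1 q.2 := measurable_snd.mul hf_meas
  have transfer {g : E × ℝ → ℝ} (hg : Measurable g) (hgi : Integrable (fun ω => g (Y ω, Z ω)) P) :
      Integrable g ((P.map Y).prod (gaussianReal 0 v)) := by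
    rw [← hlaw.map_eq, integrable_map_measure hg.aestronglyMeasurable hlaw.aemeasurable]
    exact hgi
  have hfint := transfer hf_meas hf
  have hzint := transfer hZf_meas hZf
  have hf'int := transfer hf'_meas hf'
  calc ∫ ω, Z ω * f (Y ω) (Z ω) ∂P
      = ∫ y, ∫ z, z * f y z ∂gaussianReal 0 v ∂P.map Y :=
        (hlaw.integral_comp hZf_meas.aestronglyMeasurable).trans (integral_prod _ hzint)
    _ = ∫ y, v * ∫ z, f' y z ∂gaussianReal 0 v ∂P.map Y := by
        refine integral_congr_ae ?_
        filter_upwards [hfint.prod_right_ae, hzint.prod_right_ae, hf'int.prod_right_ae]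
          with y hy hzy hy'
        simpa using integral_sub_mul_gaussianReal (hderiv y) hy (by simpa using hzy) hy'
    _ = v * ∫ ω, f' (Y ω) (Z ω) ∂P := by
        rw [integral_const_mul, ← integral_prod _ hf'int]
        exact congrArg _ (hlaw.integral_comp hf'_meas.aestronglyMeasurable).symm

end SteinLemma

section FiniteMoments

variable {Ω : Type*} [MeasurableSpace Ω] {P : Measure Ω} {f g : Ω → ℝ}

/-- `f` has finite absolute moments of all orders. Unlike membership in a fixed `Lᵖ`, this property
is stable under products, hence under polynomials. -/
def HasFiniteMoments (f : Ω → ℝ) (P : Measure Ω) : Prop :=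
  ∀ r : ℝ≥0∞, r ≠ ∞ → MemLp f r P

theorem HasFiniteMoments.memLp_two (hf : HasFiniteMoments f P) : MemLp f 2 P :=
  hf 2 ENNReal.ofNat_ne_top

theorem HasFiniteMoments.integrable (hf : HasFiniteMoments f P) : Integrable f P :=
  memLp_one_iff_integrable.1 (hf 1 ENNReal.one_ne_top)

theorem HasFiniteMoments.mul (hf : HasFiniteMoments f P) (hg : HasFiniteMoments g P) :
    HasFiniteMoments (fun ω => f ω * g ω) P := by
  intro r hr
  have h2r : 2 * r ≠ ∞ := ENNReal.mul_ne_top ENNReal.ofNat_ne_top hr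
  have : ENNReal.HolderTriple (2 * r) (2 * r) r := ⟨by
    rw [ENNReal.mul_inv (by simp) (by simp), ← add_mul, ENNReal.inv_two_add_inv_two, one_mul]⟩
  exact (hg _ h2r).mul' (hf _ h2r)

theorem HasFiniteMoments.mvPolynomial_eval [IsFiniteMeasure P] {ι : Type*} {V : ι → Ω → ℝ}
    (hV : ∀ i, HasFiniteMoments (V i) P) (p : MvPolynomial ι ℝ) :
    HasFiniteMoments (fun ω => MvPolynomial.eval (V · ω) p) P := by
  induction p using MvPolynomial.induction_on with
  | C a => exact fun r _ => by simpa using memLp_const a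
  | add p q hp hq => exact fun r hr => by simpa using! (hp r hr).add (hq r hr)
  | mul_X p i hp => simpa only [map_mul, MvPolynomial.eval_X] using hp.mul (hV i)

end FiniteMoments

section Isonormal

variable {Ω : Type*} [MeasurableSpace Ω] {P : Measure Ω} {H : Type*} [NormedAddCommGroup H]
  [InnerProductSpace ℝ H] {W : H → Ω → ℝ}

theorem IsIsonormal.hasFiniteMoments (hW : IsIsonormal W P) (x : H) :
    HasFiniteMoments (W x) P :=
  have := hW.gaussian.isProbabilityMeasure
  fun _ hr => (hW.gaussian.hasGaussianLaw_eval x).memLp hr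

theorem IsIsonormal.hasFiniteMoments_eval (hW : IsIsonormal W P) (p : MvPolynomial H ℝ) :
    HasFiniteMoments (fun ω => MvPolynomial.eval (W · ω) p) P :=
  have := hW.gaussian.isProbabilityMeasure
  .mvPolynomial_eval hW.hasFiniteMoments p

theorem IsIsonormal.hasLaw (hW : IsIsonormal W P) (g : H) :
    HasLaw (W g) (gaussianReal 0 (‖g‖₊ ^ 2)) P where
  aemeasurable := hW.gaussian.aemeasurable g
  map_eq := by
    have := hW.gaussian.isProbabilityMeasure
    have hvar : Var[W g; P] = ‖g‖ ^ 2 := by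
      rw [variance_of_integral_eq_zero (hW.gaussian.aemeasurable g) (hW.centered g),
        ← real_inner_self_eq_norm_sq, ← hW.covariance g g]
      simp only [pow_two]
    rw [(hW.gaussian.hasGaussianLaw_eval g).map_eq_gaussianReal, hvar, hW.centered g]
    congr 1
    ext
    simp

theorem inner_div_norm_sq_mul_norm_sq (x g : H) : ⟪x, g⟫ / ‖g‖ ^ 2 * ‖g‖ ^ 2 = ⟪x, g⟫ :=
  div_mul_cancel_of_imp fun hg => by simp [norm_eq_zero.1 (pow_eq_zero_iff two_ne_zero |>.1 hg)]

theorem IsIsonormal.covariance_residual (hW : IsIsonormal W P) (x g : H) :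
    cov[fun ω => W x ω - ⟪x, g⟫ / ‖g‖ ^ 2 * W g ω, W g; P] = 0 := by
  have := hW.gaussian.isProbabilityMeasure
  have hL2 (y : H) : MemLp (W y) 2 P := (hW.hasFiniteMoments y).memLp_two
  have hcov (y z : H) : cov[W y, W z; P] = ⟪y, z⟫ := by
    rw [covariance_eq_sub (hL2 y) (hL2 z), hW.centered y, zero_mul, sub_zero, ← hW.covariance]
    rfl
  rw [covariance_fun_sub_left (hL2 x) ((hL2 g).const_mul _) (hL2 g), covariance_const_mul_left,
    hcov, hcov, real_inner_self_eq_norm_sq, inner_div_norm_sq_mul_norm_sq, sub_self]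

theorem IsIsonormal.indepFun_residual (hW : IsIsonormal W P) (g : H) :
    IndepFun (fun ω x => W x ω - ⟪x, g⟫ / ‖g‖ ^ 2 * W g ω) (W g) P := by
  classical
  have hmeas := hW.gaussian.aemeasurable
  have hgaussian : IsGaussianProcess (Sum.elim
      (fun (x : H) ω => W x ω - ⟪x, g⟫ / ‖g‖ ^ 2 * W g ω) (fun _ : Unit => W g)) P := by
    refine hW.gaussian.of_isGaussianProcess ?_
    rintro (x | _)
    · exact ⟨{x, g}, ContinuousLinearMap.proj ⟨x, by simp⟩ -
        (⟪x, g⟫ / ‖g‖ ^ 2) • ContinuousLinearMap.proj ⟨g, by simp⟩, fun ω => by simp⟩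
    · exact ⟨{g}, ContinuousLinearMap.proj ⟨g, by simp⟩, fun ω => by simp⟩
  have hindep := hgaussian.indepFun_of_covariance_eq_zero
    (fun x => (hmeas x).sub ((hmeas g).const_mul _)) (fun _ => hmeas g)
    (fun x _ => hW.covariance_residual x g)
  exact hindep.comp measurable_id (measurable_pi_apply ())

/-- The expectation `p ↦ E[p(W)]` of polynomials in an isonormal process, as a linear functional. -/
noncomputable def IsIsonormal.expectation (hW : IsIsonormal W P) : MvPolynomial H ℝ →ₗ[ℝ] ℝ where
  toFun p := ∫ ω, MvPolynomial.eval (W · ω) p ∂P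
  map_add' p q := by
    simp only [map_add]
    exact integral_add (hW.hasFiniteMoments_eval p).integrable
      (hW.hasFiniteMoments_eval q).integrable
  map_smul' c p := by
    simp [MvPolynomial.smul_eval, integral_const_mul]

theorem IsIsonormal.expectation_apply (hW : IsIsonormal W P) (p : MvPolynomial H ℝ) :
    hW.expectation p = ∫ ω, MvPolynomial.eval (W · ω) p ∂P :=
  rfl

@[simp]
theorem IsIsonormal.expectation_C (hW : IsIsonormal W P) (c : ℝ) :
    hW.expectation (MvPolynomial.C c) = c := by
  have := hW.gaussian.isProbabilityMeasure
  simp [hW.expectation_apply]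

-- Given the residuals `W x - ⟪x, g⟫ / ‖g‖² W g`, a polynomial in `W` is a polynomial in the
-- independent Gaussian variable `W g`.
theorem IsIsonormal.expectation_X_mul (hW : IsIsonormal W P) (g : H) (p : MvPolynomial H ℝ) :
    hW.expectation (MvPolynomial.X g * p) = hW.expectation (dirDeriv (⟪·, g⟫) p) := by
  obtain ⟨k, x, -, q, rfl⟩ := MvPolynomial.exists_fin_rename p
  let a : Fin k → ℝ := fun i => ⟪x i, g⟫ / ‖g‖ ^ 2
  let Y : Ω → Fin k → ℝ := fun ω i => W (x i) ω - a i * W g ω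
  have hY : AEMeasurable Y P := aemeasurable_pi_lambda _ fun i =>
    (hW.gaussian.aemeasurable _).sub ((hW.gaussian.aemeasurable g).const_mul _)
  have hYZ : IndepFun Y (W g) P := (hW.indepFun_residual g).comp
    (measurable_pi_lambda _ fun i => measurable_pi_apply (x i)) measurable_id
  have hdecomp (ω : Ω) : Y ω + W g ω • a = (W · ω) ∘ x := by
    ext i
    simp [Y, mul_comm]
  have hmeas (r : MvPolynomial (Fin k) ℝ) :
      Measurable fun z : (Fin k → ℝ) × ℝ => MvPolynomial.eval (z.1 + z.2 • a) r :=
    (r.continuous_eval.comp (by fun_prop)).measurable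
  have ha : ‖g‖ ^ 2 • a = (⟪·, g⟫) ∘ x := by
    ext i
    simpa [a, mul_comm] using inner_div_norm_sq_mul_norm_sq (x i) g
  have hfint (r : MvPolynomial (Fin k) ℝ) :
      Integrable (fun ω => MvPolynomial.eval (Y ω + W g ω • a) r) P := by
    simpa only [hdecomp, MvPolynomial.eval_rename]
      using (hW.hasFiniteMoments_eval (MvPolynomial.rename x r)).integrable
  have hXint : Integrable (fun ω => W g ω * MvPolynomial.eval (Y ω + W g ω • a) q) P := by
    refine (hW.hasFiniteMoments_eval (.X g * MvPolynomial.rename x q)).integrable.congr ?_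
    exact .of_forall fun ω => by simp [hdecomp, MvPolynomial.eval_rename]
  have hstein := integral_mul_of_indepFun_gaussianReal hY (hW.hasLaw g) hYZ
    (fun y z => hasDerivAt_eval_add_smul q y a z) (hmeas q) (hmeas _) (hfint q) hXint (hfint _)
  rw [dirDeriv_rename, ← ha, dirDeriv_smul]
  simpa [hW.expectation_apply, MvPolynomial.eval_rename, hdecomp, integral_const_mul] using hstein

end Isonormal

section HermitePolynomials

/-- The probabilists' Hermite polynomial with real coefficients. -/
noncomputable def hermiteReal (n : ℕ) : Polynomial ℝ :=
  (Polynomial.hermite n).map (Int.castRingHom ℝ)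

theorem eval_hermiteReal (n : ℕ) (x : ℝ) :
    (hermiteReal n).eval x = Polynomial.aeval x (Polynomial.hermite n) := by
  rw [hermiteReal, Polynomial.eval_map, Polynomial.aeval_def]
  rfl

@[simp]
theorem hermiteReal_zero : hermiteReal 0 = 1 := by simp [hermiteReal]

theorem hermiteReal_succ (n : ℕ) :
    hermiteReal (n + 1) = Polynomial.X * hermiteReal n - (hermiteReal n).derivative := by
  simp [hermiteReal, Polynomial.hermite_succ, Polynomial.derivative_map]

theorem monic_hermiteReal (n : ℕ) : (hermiteReal n).Monic :=
  (Polynomial.hermite_monic n).map _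

@[simp]
theorem natDegree_hermiteReal (n : ℕ) : (hermiteReal n).natDegree = n := by
  rw [hermiteReal, (Polynomial.hermite_monic n).natDegree_map, Polynomial.natDegree_hermite]

theorem iterate_derivative_natDegree {R : Type*} [Semiring R] (p : Polynomial R) :
    Polynomial.derivative^[p.natDegree] p =
      Polynomial.C (p.natDegree.factorial • p.leadingCoeff) := by
  have hdegree := Polynomial.natDegree_iterate_derivative p p.natDegree
  rw [Nat.sub_self, Nat.le_zero] at hdegree
  rw [Polynomial.eq_C_of_natDegree_eq_zero hdegree, Polynomial.coeff_iterate_derivative]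
  simp [Nat.descFactorial_self]

variable {Ω : Type*} [MeasurableSpace Ω] {P : Measure Ω} {H : Type*} [NormedAddCommGroup H]
  [InnerProductSpace ℝ H] {W : H → Ω → ℝ}

theorem IsIsonormal.expectation_hermiteReal_mul (hW : IsIsonormal W P) {h : H} (hh : ‖h‖ = 1)
    (n : ℕ) (p : MvPolynomial H ℝ) :
    hW.expectation (Polynomial.aeval (MvPolynomial.X h) (hermiteReal n) * p) =
      hW.expectation ((dirDeriv (⟪·, h⟫))^[n] p) := by
  induction n generalizing p with
  | zero => simp
  | succ n ih =>
    have hderiv : dirDeriv (⟪·, h⟫) (Polynomial.aeval (MvPolynomial.X h) (hermiteReal n)) =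
        Polynomial.aeval (MvPolynomial.X h) (hermiteReal n).derivative := by
      rw [dirDeriv_aeval_X, real_inner_self_eq_norm_sq, hh, one_pow, one_smul]
    rw [Function.iterate_succ_apply, ← ih, hermiteReal_succ, map_sub,
      map_mul (Polynomial.aeval _), Polynomial.aeval_X, sub_mul, mul_assoc, map_sub,
      hW.expectation_X_mul, Derivation.leibniz, hderiv, map_add, smul_eq_mul,
      smul_eq_mul, mul_comm p, add_sub_cancel_right]

theorem IsIsonormal.expectation_hermiteReal_mul_hermiteReal (hW : IsIsonormal W P) {h k : H}
    (hh : ‖h‖ = 1) (hk : ‖k‖ = 1) (n m : ℕ) :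
    hW.expectation (Polynomial.aeval (MvPolynomial.X h) (hermiteReal n) *
        Polynomial.aeval (MvPolynomial.X k) (hermiteReal m)) =
      if n = m then n.factorial * ⟪h, k⟫ ^ n else 0 := by
  wlog hmn : m ≤ n generalizing h k n m
  · rw [mul_comm, this hk hh m n (by omega), real_inner_comm]
    exact ite_congr (propext eq_comm) (fun hnm => by rw [hnm]) fun _ => rfl
  rw [hW.expectation_hermiteReal_mul hh, iterate_dirDeriv_aeval_X, map_smul, real_inner_comm]
  split_ifs with hnm
  · subst hnm
    have hderiv := iterate_derivative_natDegree (hermiteReal n)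
    rw [natDegree_hermiteReal, (monic_hermiteReal n).leadingCoeff] at hderiv
    rw [hderiv, Polynomial.aeval_C, MvPolynomial.algebraMap_eq, hW.expectation_C]
    simp [mul_comm]
  · rw [Polynomial.iterate_derivative_eq_zero (by rw [natDegree_hermiteReal]; omega)]
    simp

end HermitePolynomials

section PolynomialRandomVariables

variable {Ω : Type*} [MeasurableSpace Ω] {P : Measure Ω} {H : Type*} [NormedAddCommGroup H]
  [InnerProductSpace ℝ H] {W : H → Ω → ℝ}

/-- The random variable `p(W)`, as an element of `L²(P)`. -/
noncomputable def IsIsonormal.evalLp (hW : IsIsonormal W P) (p : MvPolynomial H ℝ) : Lp ℝ 2 P :=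
  (hW.hasFiniteMoments_eval p).memLp_two.toLp

theorem IsIsonormal.coeFn_evalLp (hW : IsIsonormal W P) (p : MvPolynomial H ℝ) :
    hW.evalLp p =ᵐ[P] fun ω => MvPolynomial.eval (W · ω) p :=
  MemLp.coeFn_toLp _

theorem IsIsonormal.inner_evalLp_evalLp (hW : IsIsonormal W P) (p q : MvPolynomial H ℝ) :
    ⟪hW.evalLp p, hW.evalLp q⟫ = hW.expectation (p * q) := by
  rw [L2.inner_def, hW.expectation_apply]
  refine integral_congr_ae ?_
  filter_upwards [hW.coeFn_evalLp p, hW.coeFn_evalLp q] with ω hp hq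
  simp [hp, hq, mul_comm]

theorem IsIsonormal.covariance_evalLp_evalLp (hW : IsIsonormal W P) (p q : MvPolynomial H ℝ) :
    cov[hW.evalLp p, hW.evalLp q; P] =
      hW.expectation (p * q) - hW.expectation p * hW.expectation q := by
  have := hW.gaussian.isProbabilityMeasure
  rw [covariance_eq_sub (Lp.memLp _) (Lp.memLp _), integral_congr_ae (hW.coeFn_evalLp p),
    integral_congr_ae (hW.coeFn_evalLp q),
    integral_congr_ae ((hW.coeFn_evalLp p).mul (hW.coeFn_evalLp q))]
  simp only [hW.expectation_apply, map_mul, Pi.mul_apply]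

end PolynomialRandomVariables

section ScalarTimesVector

variable {Ω : Type*} [MeasurableSpace Ω] {P : Measure Ω}

/-- The map `F ↦ F g` from `L²(P)` to `L²(P; E)`, whose values are the elementary tensors
`F ⊗ g`. -/
noncomputable def smulLp {E : Type*} [NormedAddCommGroup E] [NormedSpace ℝ E] (P : Measure Ω)
    (g : E) : Lp ℝ 2 P →L[ℝ] Lp E 2 P :=
  (ContinuousLinearMap.toSpanSingleton ℝ g).compLpL 2 P

theorem coeFn_smulLp {E : Type*} [NormedAddCommGroup E] [NormedSpace ℝ E] (g : E)
    (F : Lp ℝ 2 P) : smulLp P g F =ᵐ[P] fun ω => F ω • g :=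
  ContinuousLinearMap.coeFn_compLpL _ F

theorem inner_smulLp_smulLp {E : Type*} [NormedAddCommGroup E] [InnerProductSpace ℝ E] (g k : E)
    (F G : Lp ℝ 2 P) : ⟪smulLp P g F, smulLp P k G⟫ = ⟪g, k⟫ * ⟪F, G⟫ := by
  rw [L2.inner_def, L2.inner_def, ← integral_const_mul]
  refine integral_congr_ae ?_
  filter_upwards [coeFn_smulLp g F, coeFn_smulLp k G] with ω hF hG
  rw [hF, hG, real_inner_smul_left, real_inner_smul_right]
  simp only [RCLike.inner_apply, Real.ringHom_apply]
  ring

end ScalarTimesVector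

section ClosedGraphs

variable {E F : Type*} [NormedAddCommGroup E] [InnerProductSpace ℝ E] [NormedAddCommGroup F]
  [InnerProductSpace ℝ F] {S : Set (E × F)}

theorem inner_snd_eq_of_mem_topologicalClosure_span (a : E) (b : F)
    (hS : ∀ q ∈ S, ⟪b, q.2⟫ = ⟪a, q.1⟫) {q : E × F}
    (hq : q ∈ (Submodule.span ℝ S).topologicalClosure) : ⟪b, q.2⟫ = ⟪a, q.1⟫ := by
  let L : E × F →L[ℝ] ℝ := (innerSL ℝ b) ∘L (ContinuousLinearMap.snd ℝ E F) -
    (innerSL ℝ a) ∘L (ContinuousLinearMap.fst ℝ E F)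
  have hle : (Submodule.span ℝ S).topologicalClosure ≤ L.ker :=
    Submodule.topologicalClosure_minimal _
      (Submodule.span_le.2 fun q hq => by simpa [L, sub_eq_zero] using hS q hq) L.isClosed_ker
  simpa [L, sub_eq_zero] using hle hq

theorem inner_snd_snd_eq_of_mem_topologicalClosure_span (c : ℝ)
    (hS : ∀ q ∈ S, ∀ r ∈ S, ⟪q.2, r.2⟫ = c * ⟪q.1, r.1⟫) {q r : E × F}
    (hq : q ∈ (Submodule.span ℝ S).topologicalClosure)
    (hr : r ∈ (Submodule.span ℝ S).topologicalClosure) : ⟪q.2, r.2⟫ = c * ⟪q.1, r.1⟫ := by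
  have hleft {q : E × F} (hq : q ∈ S) : ⟪q.2, r.2⟫ = ⟪c • q.1, r.1⟫ :=
    inner_snd_eq_of_mem_topologicalClosure_span (c • q.1) q.2
      (fun r hr => by rw [real_inner_smul_left, hS q hq r hr]) hr
  have hright := inner_snd_eq_of_mem_topologicalClosure_span (c • r.1) r.2
    (fun q hq => by rw [real_inner_comm, hleft hq, real_inner_smul_left, real_inner_smul_left,
      real_inner_comm]) hq
  rw [real_inner_comm, hright, real_inner_smul_left, real_inner_comm]

end ClosedGraphs

section MultipleIntegral

variable {Ω : Type*} [MeasurableSpace Ω] {P : Measure Ω} {H : Type*} [NormedAddCommGroup H]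
  [InnerProductSpace ℝ H] {W : H → Ω → ℝ}

theorem IsIsonormal.eq_evalLp_hermiteReal (hW : IsIsonormal W P) {h : H} {n : ℕ} {F : Lp ℝ 2 P}
    (hF : F =ᵐ[P] fun ω => Polynomial.aeval (W h ω) (Polynomial.hermite n)) :
    F = hW.evalLp (Polynomial.aeval (MvPolynomial.X h) (hermiteReal n)) := by
  refine Lp.ext (hF.trans (.trans (.of_forall fun ω => ?_) (hW.coeFn_evalLp _).symm))
  rw [eval_aeval_X, eval_hermiteReal]

theorem IsIsonormal.inner_of_mem_multipleIntegralGraph (hW : IsIsonormal W P) {n : ℕ}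
    {q r : HilbertTensorPower H n × Lp ℝ 2 P} (hq : q ∈ multipleIntegralGraph W P n)
    (hr : r ∈ multipleIntegralGraph W P n) : ⟪q.2, r.2⟫ = n.factorial * ⟪q.1, r.1⟫ := by
  refine inner_snd_snd_eq_of_mem_topologicalClosure_span _ ?_ hq hr
  rintro ⟨s, F⟩ ⟨h, hh, hs, hF⟩ ⟨t, G⟩ ⟨k, hk, ht, hG⟩
  dsimp only at hs ht hF hG ⊢
  rw [hs, ht, inner_tensorPow, hW.eq_evalLp_hermiteReal hF, hW.eq_evalLp_hermiteReal hG,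
    hW.inner_evalLp_evalLp, hW.expectation_hermiteReal_mul_hermiteReal hh hk, if_pos rfl]

theorem IsIsonormal.multipleIntegral_eq (hW : IsIsonormal W P) {n : ℕ}
    {f : HilbertTensorPower H n} {F : Lp ℝ 2 P} (hf : (f, F) ∈ multipleIntegralGraph W P n) :
    multipleIntegral W P n f = F := by
  have hex : ∃ F, (f, F) ∈ multipleIntegralGraph W P n := ⟨F, hf⟩
  have hmem : (0, hex.choose - F) ∈ multipleIntegralGraph W P n := by
    simpa using Submodule.sub_mem _ hex.choose_spec hf
  rw [multipleIntegral, dif_pos hex, ← sub_eq_zero, ← inner_self_eq_zero (𝕜 := ℝ),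
    hW.inner_of_mem_multipleIntegralGraph hmem hmem, inner_zero_left, mul_zero]

theorem IsIsonormal.multipleIntegral_tensorPow (hW : IsIsonormal W P) {h : H} (hh : ‖h‖ = 1)
    (n : ℕ) : multipleIntegral W P n (tensorPow n h) =
      hW.evalLp (Polynomial.aeval (MvPolynomial.X h) (hermiteReal n)) := by
  refine hW.multipleIntegral_eq
    (Submodule.le_topologicalClosure _ (Submodule.subset_span ⟨h, hh, rfl, ?_⟩))
  filter_upwards [hW.coeFn_evalLp (Polynomial.aeval (MvPolynomial.X h) (hermiteReal n))] with ω hω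
  rw [hω, eval_aeval_X, eval_hermiteReal]

end MultipleIntegral

section MalliavinDerivative

variable {Ω : Type*} [MeasurableSpace Ω] {P : Measure Ω} {H : Type*} [NormedAddCommGroup H]
  [InnerProductSpace ℝ H] {W : H → Ω → ℝ}

/-- The Malliavin derivative `∑ᵢ ∂ᵢu(W(x₁), …, W(xₖ)) xᵢ` of the cylindrical random variable
`u(W(x₁), …, W(xₖ))`. -/
noncomputable def IsIsonormal.gradLp (hW : IsIsonormal W P) {k : ℕ} (x : Fin k → H)
    (u : MvPolynomial (Fin k) ℝ) : Lp H 2 P :=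
  ∑ i, smulLp P (x i) (hW.evalLp (MvPolynomial.rename x (MvPolynomial.pderiv i u)))

theorem IsIsonormal.coeFn_gradLp (hW : IsIsonormal W P) {k : ℕ} (x : Fin k → H)
    (u : MvPolynomial (Fin k) ℝ) : hW.gradLp x u =ᵐ[P]
      fun ω => ∑ i, MvPolynomial.eval (fun j => W (x j) ω) (MvPolynomial.pderiv i u) • x i := by
  refine (Lp.coeFn_finsetSum _ _).trans ?_
  filter_upwards [ae_all_iff.2 fun i => coeFn_smulLp (x i)
      (hW.evalLp (MvPolynomial.rename x (MvPolynomial.pderiv i u))),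
    ae_all_iff.2 fun i => hW.coeFn_evalLp (MvPolynomial.rename x (MvPolynomial.pderiv i u))]
    with ω hsmul heval
  simp only [Finset.sum_apply, hsmul, heval, MvPolynomial.eval_rename]
  rfl

theorem IsIsonormal.malliavinGraph_eq (hW : IsIsonormal W P) :
    malliavinGraph W P = (Submodule.span ℝ {q | ∃ (k : ℕ) (x : Fin k → H)
      (u : MvPolynomial (Fin k) ℝ), q = (hW.evalLp (MvPolynomial.rename x u), hW.gradLp x u)}
      ).topologicalClosure := by
  rw [malliavinGraph]
  congr 2
  ext q
  refine exists₃_congr fun k x u => ?_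
  have heval : hW.evalLp (MvPolynomial.rename x u) =ᵐ[P]
      fun ω => MvPolynomial.eval (fun i => W (x i) ω) u := by
    simpa only [MvPolynomial.eval_rename] using! hW.coeFn_evalLp (MvPolynomial.rename x u)
  rw [Prod.ext_iff, Lp.ext_iff, Lp.ext_iff]
  exact and_congr ⟨(·.trans heval.symm), (·.trans heval)⟩
    ⟨(·.trans (hW.coeFn_gradLp x u).symm), (·.trans (hW.coeFn_gradLp x u))⟩

theorem IsIsonormal.inner_smulLp_gradLp (hW : IsIsonormal W P) (g : H) (p : MvPolynomial H ℝ)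
    {k : ℕ} (x : Fin k → H) (u : MvPolynomial (Fin k) ℝ) :
    ⟪smulLp P g (hW.evalLp p), hW.gradLp x u⟫ =
      hW.expectation (p * dirDeriv (⟪·, g⟫) (MvPolynomial.rename x u)) := by
  simp only [IsIsonormal.gradLp, inner_sum, inner_smulLp_smulLp, hW.inner_evalLp_evalLp,
    dirDeriv_rename, dirDeriv_eq_sum_pderiv, map_sum, map_smul, Finset.mul_sum, mul_smul_comm,
    smul_eq_mul, Function.comp_apply, real_inner_comm g]

-- The variables `p(W) g` lie in the domain of the adjoint of `D`; as `D` takes its values in their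
-- closed span, this makes `D` closable.
theorem IsIsonormal.inner_smulLp_of_mem_malliavinGraph (hW : IsIsonormal W P) (g : H)
    (p : MvPolynomial H ℝ) {q : Lp ℝ 2 P × Lp H 2 P} (hq : q ∈ malliavinGraph W P) :
    ⟪smulLp P g (hW.evalLp p), q.2⟫ =
      ⟪hW.evalLp (MvPolynomial.X g * p - dirDeriv (⟪·, g⟫) p), q.1⟫ := by
  rw [hW.malliavinGraph_eq] at hq
  refine inner_snd_eq_of_mem_topologicalClosure_span _ _ ?_ hq
  rintro _ ⟨k, x, u, rfl⟩
  rw [hW.inner_smulLp_gradLp, hW.inner_evalLp_evalLp, sub_mul, mul_assoc, map_sub,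
    hW.expectation_X_mul, Derivation.leibniz, map_add, smul_eq_mul, smul_eq_mul,
    mul_comm (MvPolynomial.rename x u), add_sub_cancel_right]

theorem IsIsonormal.eq_zero_of_mem_malliavinGraph (hW : IsIsonormal W P) {U : Lp H 2 P}
    (hU : (0, U) ∈ malliavinGraph W P) : U = 0 := by
  have hsmul (g : H) (p : MvPolynomial H ℝ) : ⟪U, smulLp P g (hW.evalLp p)⟫ = 0 := by
    rw [real_inner_comm, hW.inner_smulLp_of_mem_malliavinGraph g p hU, inner_zero_right]
  have hself : ⟪U, U⟫ = ⟪(0 : Lp ℝ 2 P), (0 : Lp ℝ 2 P)⟫ := by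
    rw [hW.malliavinGraph_eq] at hU
    refine inner_snd_eq_of_mem_topologicalClosure_span 0 U ?_ hU
    rintro _ ⟨k, x, u, rfl⟩
    simp [IsIsonormal.gradLp, inner_sum, hsmul]
  simpa using hself

theorem IsIsonormal.malliavinDeriv_eq (hW : IsIsonormal W P) {F : Lp ℝ 2 P} {U : Lp H 2 P}
    (hF : (F, U) ∈ malliavinGraph W P) : malliavinDeriv W P F = U := by
  have hex : IsMalliavinDifferentiable W P F := ⟨U, hF⟩
  have hmem : (0, hex.choose - U) ∈ malliavinGraph W P := by
    simpa using Submodule.sub_mem _ hex.choose_spec hF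
  rw [malliavinDeriv, dif_pos hex, ← sub_eq_zero, hW.eq_zero_of_mem_malliavinGraph hmem]

theorem IsIsonormal.mem_malliavinGraph_aeval_X (hW : IsIsonormal W P) (h : H)
    (q : Polynomial ℝ) : (hW.evalLp (Polynomial.aeval (MvPolynomial.X h) q),
      smulLp P h (hW.evalLp (Polynomial.aeval (MvPolynomial.X h) q.derivative))) ∈
        malliavinGraph W P := by
  rw [hW.malliavinGraph_eq]
  refine Submodule.le_topologicalClosure _ (Submodule.subset_span
    ⟨1, fun _ => h, Polynomial.aeval (MvPolynomial.X 0) q, ?_⟩)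
  simp [IsIsonormal.gradLp, Derivation.map_aeval, ← Polynomial.aeval_algHom_apply]

theorem IsIsonormal.isMalliavinDifferentiable_aeval_X (hW : IsIsonormal W P) (h : H)
    (q : Polynomial ℝ) :
    IsMalliavinDifferentiable W P (hW.evalLp (Polynomial.aeval (MvPolynomial.X h) q)) :=
  ⟨_, hW.mem_malliavinGraph_aeval_X h q⟩

theorem IsIsonormal.malliavinDeriv_aeval_X (hW : IsIsonormal W P) (h : H) (q : Polynomial ℝ) :
    malliavinDeriv W P (hW.evalLp (Polynomial.aeval (MvPolynomial.X h) q)) =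
      smulLp P h (hW.evalLp (Polynomial.aeval (MvPolynomial.X h) q.derivative)) :=
  hW.malliavinDeriv_eq (hW.mem_malliavinGraph_aeval_X h q)

theorem det_malliavinMatrix_eq_zero {F G A B : Lp ℝ 2 P} {h : H}
    (hF : malliavinDeriv W P F = smulLp P h A) (hG : malliavinDeriv W P G = smulLp P h B) :
    ∀ᵐ ω ∂P, (malliavinMatrix W P F G ω).det = 0 := by
  filter_upwards [coeFn_smulLp h A, coeFn_smulLp h B] with ω hA hB
  rw [malliavinMatrix, hF, hG, Matrix.det_fin_two_of, hA, hB]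
  simp only [real_inner_smul_left, real_inner_smul_right]
  ring

end MalliavinDerivative

section JointDensity

theorem volume_range_eq_zero_of_contDiff {γ : ℝ → ℝ × ℝ} (hγ : ContDiff ℝ 1 γ) :
    volume (Set.range γ) = 0 := by
  have hdim : dimH (Set.range γ) < (2 : NNReal) := hγ.dimH_range_le.trans_lt (by simp)
  simpa [hausdorffMeasure_prod_real] using hausdorffMeasure_of_dimH_lt hdim

variable {Ω : Type*} [MeasurableSpace Ω] {P : Measure Ω} {F G : Lp ℝ 2 P}

theorem not_hasJointDensity_of_ae_mem_range [NeZero P] {γ : ℝ → ℝ × ℝ} (hγ : ContDiff ℝ 1 γ)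
    (hFG : ∀ᵐ ω ∂P, (F ω, G ω) ∈ Set.range γ) : ¬ HasJointDensity P F G := by
  intro hdensity
  have hmeas : AEMeasurable (fun ω => (F ω, G ω)) P :=
    (Lp.aestronglyMeasurable F).aemeasurable.prodMk (Lp.aestronglyMeasurable G).aemeasurable
  have hnotMem : ∀ᵐ ω ∂P, (F ω, G ω) ∉ Set.range γ := ae_of_ae_map hmeas
    (measure_eq_zero_iff_ae_notMem.1 (hdensity (volume_range_eq_zero_of_contDiff hγ)))
  obtain ⟨ω, hmem, hω⟩ := (hFG.and hnotMem).exists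
  exact hω hmem

end JointDensity

section CovarianceMatrix

variable {Ω : Type*} [MeasurableSpace Ω] {P : Measure Ω} {F G : Lp ℝ 2 P}

theorem AreProportional.det_covMatrix_eq_zero [IsProbabilityMeasure P]
    (hFG : AreProportional P F G) : (covMatrix P F G).det = 0 := by
  obtain ⟨a, b, hab, hzero⟩ := hFG
  have hae : a • (F : Ω → ℝ) + b • (G : Ω → ℝ) =ᵐ[P] 0 := by
    filter_upwards [Lp.coeFn_add (a • F) (b • G), Lp.coeFn_smul a F, Lp.coeFn_smul b G,
      Lp.coeFn_zero ℝ 2 P] with ω hadd hF hG hω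
    rw [Pi.add_apply, ← hF, ← hG, ← Pi.add_apply, ← hadd, hzero, hω]
  have hcov (K : Lp ℝ 2 P) : a * cov[K, F; P] + b * cov[K, G; P] = 0 := by
    have haF := (Lp.memLp F).const_smul a
    have hbG := (Lp.memLp G).const_smul b
    rw [← covariance_smul_right, ← covariance_smul_right,
      ← covariance_add_right (Lp.memLp K) haF hbG, covariance_eq_sub (Lp.memLp K) (haF.add hbG),
      integral_eq_zero_of_ae hae, integral_eq_zero_of_ae]
    · simp
    · filter_upwards [hae] with ω hω
      rw [Pi.mul_apply, hω, Pi.zero_apply, mul_zero]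
  refine Matrix.exists_mulVec_eq_zero_iff.1 ⟨![a, b], ?_, ?_⟩
  · simpa [or_iff_not_imp_left] using hab
  · ext i
    fin_cases i <;> simpa [covMatrix, Matrix.vecHead, Matrix.vecTail] using! hcov _

end CovarianceMatrix

section HermiteVector

variable {Ω : Type*} [MeasurableSpace Ω] {P : Measure Ω} {H : Type*} [NormedAddCommGroup H]
  [InnerProductSpace ℝ H] {W : H → Ω → ℝ}

theorem IsIsonormal.expectation_hermiteReal (hW : IsIsonormal W P) {h : H} (hh : ‖h‖ = 1) {n : ℕ}
    (hn : n ≠ 0) :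
    hW.expectation (Polynomial.aeval (MvPolynomial.X h) (hermiteReal n)) = 0 := by
  simpa [hn] using hW.expectation_hermiteReal_mul_hermiteReal hh hh n 0

theorem IsIsonormal.covariance_multipleIntegral_tensorPow (hW : IsIsonormal W P) {h k : H}
    (hh : ‖h‖ = 1) (hk : ‖k‖ = 1) {n m : ℕ} (hn : n ≠ 0) :
    cov[multipleIntegral W P n (tensorPow n h), multipleIntegral W P m (tensorPow m k); P] =
      if n = m then n.factorial * ⟪h, k⟫ ^ n else 0 := by
  rw [hW.multipleIntegral_tensorPow hh, hW.multipleIntegral_tensorPow hk,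
    hW.covariance_evalLp_evalLp, hW.expectation_hermiteReal hh hn, zero_mul, sub_zero,
    hW.expectation_hermiteReal_mul_hermiteReal hh hk]

theorem IsIsonormal.det_covMatrix_multipleIntegral (hW : IsIsonormal W P) {h k : H}
    (hh : ‖h‖ = 1) (hk : ‖k‖ = 1) {n m : ℕ} (hn : n ≠ 0) (hm : m ≠ 0) (hnm : n ≠ m) :
    (covMatrix P (multipleIntegral W P n (tensorPow n h))
      (multipleIntegral W P m (tensorPow m k))).det = n.factorial * m.factorial := by
  rw [covMatrix, Matrix.det_fin_two_of,
    hW.covariance_multipleIntegral_tensorPow hh hh hn,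
    hW.covariance_multipleIntegral_tensorPow hk hk hm,
    hW.covariance_multipleIntegral_tensorPow hh hk hn]
  simp [hnm, hh, hk]

theorem IsIsonormal.isMalliavinDifferentiable_multipleIntegral (hW : IsIsonormal W P) {h : H}
    (hh : ‖h‖ = 1) (n : ℕ) :
    IsMalliavinDifferentiable W P (multipleIntegral W P n (tensorPow n h)) := by
  rw [hW.multipleIntegral_tensorPow hh]
  exact hW.isMalliavinDifferentiable_aeval_X h _

theorem IsIsonormal.det_malliavinMatrix_multipleIntegral (hW : IsIsonormal W P) {h : H}
    (hh : ‖h‖ = 1) (n m : ℕ) :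
    ∀ᵐ ω ∂P, (malliavinMatrix W P (multipleIntegral W P n (tensorPow n h))
      (multipleIntegral W P m (tensorPow m h)) ω).det = 0 := by
  rw [hW.multipleIntegral_tensorPow hh, hW.multipleIntegral_tensorPow hh]
  exact det_malliavinMatrix_eq_zero (hW.malliavinDeriv_aeval_X h _) (hW.malliavinDeriv_aeval_X h _)

theorem IsIsonormal.not_hasJointDensity_multipleIntegral (hW : IsIsonormal W P) {h : H}
    (hh : ‖h‖ = 1) (n m : ℕ) :
    ¬ HasJointDensity P (multipleIntegral W P n (tensorPow n h))
      (multipleIntegral W P m (tensorPow m h)) := by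
  have := hW.gaussian.isProbabilityMeasure
  have hcurve : ContDiff ℝ 1 fun t : ℝ => ((hermiteReal n).eval t, (hermiteReal m).eval t) :=
    ((hermiteReal n).contDiff_aeval 1).prodMk ((hermiteReal m).contDiff_aeval 1)
  rw [hW.multipleIntegral_tensorPow hh, hW.multipleIntegral_tensorPow hh]
  refine not_hasJointDensity_of_ae_mem_range hcurve ?_
  filter_upwards [hW.coeFn_evalLp (Polynomial.aeval (MvPolynomial.X h) (hermiteReal n)),
    hW.coeFn_evalLp (Polynomial.aeval (MvPolynomial.X h) (hermiteReal m))] with ω hn hm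
  exact ⟨W h ω, by rw [hn, hm, eval_aeval_X, eval_aeval_X]⟩

end HermiteVector

end WienerChaos

theorem mainTheorem7_general {Ω : Type*} [MeasurableSpace Ω] (P : MeasureTheory.Measure Ω)
    {H : Type*} [NormedAddCommGroup H] [InnerProductSpace ℝ H]
    (W : H → Ω → ℝ) (hW : WienerChaos.IsIsonormal W P) (h : H) (hh : ‖h‖ = 1) :
    (∀ F G : MeasureTheory.Lp ℝ 2 P,
      F = WienerChaos.multipleIntegral W P 1 (WienerChaos.tensorPow 1 h) →
      G = WienerChaos.multipleIntegral W P 2 (WienerChaos.tensorPow 2 h) →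
      (WienerChaos.covMatrix P F G).det = 2 ∧
      ∀ᵐ ω ∂P, (WienerChaos.malliavinMatrix W P F G ω).det = 0) ∧
    ∀ n m : ℕ, 1 ≤ n → 1 ≤ m → n ≠ m →
      ∀ F G : MeasureTheory.Lp ℝ 2 P,
      F = WienerChaos.multipleIntegral W P n (WienerChaos.tensorPow n h) →
      G = WienerChaos.multipleIntegral W P m (WienerChaos.tensorPow m h) →
      WienerChaos.IsMalliavinDifferentiable W P F ∧
      WienerChaos.IsMalliavinDifferentiable W P G ∧
      (∀ᵐ ω ∂P, (WienerChaos.malliavinMatrix W P F G ω).det = 0) ∧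
      (WienerChaos.covMatrix P F G).det = (n.factorial : ℝ) * (m.factorial : ℝ) ∧
      (WienerChaos.covMatrix P F G).det ≠ 0 ∧
      ¬ WienerChaos.HasJointDensity P F G ∧
      ¬ WienerChaos.AreProportional P F G := by
  constructor
  · rintro F G rfl rfl
    refine ⟨?_, hW.det_malliavinMatrix_multipleIntegral hh 1 2⟩
    simpa using hW.det_covMatrix_multipleIntegral hh hh one_ne_zero two_ne_zero
      (by decide : 1 ≠ 2)
  · rintro n m hn hm hnm F G rfl rfl
    have := hW.gaussian.isProbabilityMeasure
    have hdet := hW.det_covMatrix_multipleIntegral hh hh (by omega) (by omega) hnm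
    have hdet_ne_zero : (n.factorial * m.factorial : ℝ) ≠ 0 := by positivity
    rw [← hdet] at hdet_ne_zero
    exact ⟨hW.isMalliavinDifferentiable_multipleIntegral hh n,
      hW.isMalliavinDifferentiable_multipleIntegral hh m,
      hW.det_malliavinMatrix_multipleIntegral hh n m, hdet, hdet_ne_zero,
      hW.not_hasJointDensity_multipleIntegral hh n m,
      fun hprop => hdet_ne_zero hprop.det_covMatrix_eq_zero⟩

theorem mainTheorem7 {Ω : Type*} [MeasurableSpace Ω] (P : MeasureTheory.Measure Ω)
    [MeasureTheory.IsProbabilityMeasure P]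
    {H : Type*} [NormedAddCommGroup H] [InnerProductSpace ℝ H] [CompleteSpace H]
    (W : H → Ω → ℝ) (hW : WienerChaos.IsIsonormal W P) (h : H) (hh : ‖h‖ = 1) :
    (∀ F G : MeasureTheory.Lp ℝ 2 P,
      F = WienerChaos.multipleIntegral W P 1 (WienerChaos.tensorPow 1 h) →
      G = WienerChaos.multipleIntegral W P 2 (WienerChaos.tensorPow 2 h) →
      (WienerChaos.covMatrix P F G).det = 2 ∧
      ∀ᵐ ω ∂P, (WienerChaos.malliavinMatrix W P F G ω).det = 0) ∧
    ∀ n m : ℕ, 1 ≤ n → 1 ≤ m → n ≠ m →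
      ∀ F G : MeasureTheory.Lp ℝ 2 P,
      F = WienerChaos.multipleIntegral W P n (WienerChaos.tensorPow n h) →
      G = WienerChaos.multipleIntegral W P m (WienerChaos.tensorPow m h) →
      WienerChaos.IsMalliavinDifferentiable W P F ∧
      WienerChaos.IsMalliavinDifferentiable W P G ∧
      (∀ᵐ ω ∂P, (WienerChaos.malliavinMatrix W P F G ω).det = 0) ∧
      (WienerChaos.covMatrix P F G).det = (n.factorial : ℝ) * (m.factorial : ℝ) ∧
      (WienerChaos.covMatrix P F G).det ≠ 0 ∧
      ¬ WienerChaos.HasJointDensity P F G ∧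
      ¬ WienerChaos.AreProportional P F G :=
  mainTheorem7_general P W hW h hh
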